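/- Let $d_1,d_2,d_3\ge 2$, and equip $\mathbb{R}^{d_1\times d_2\times d_3}$ with the Frobenius norm $\|A\|_F=\bigl(\sum_{i,j,k}a_{ijk}^2\bigr)^{1/2}$ and Lebesgue measure. For $x\in\mathbb{R}^{d_1}$, $y\in\mathbb{R}^{d_2}$, $z\in\mathbb{R}^{d_3}$ let $x\otimes y\otimes z$ be the tensor with entries $x_iy_jz_k$, and let $\operatorname{rank}_\otimes(A)$ be the least number $r$ such that $A$ is a sum of $r$ tensors of this form. A best rank-$2$ approximation of $A$ is a tensor $B$ with $\operatorname{rank}_\otimes(B)\le 2$ and $\|A-B\|_F\le\|A-C\|_F$ for every tensor $C\in\mathbb{R}^{d_1\times d_2\times d_3}$ with $\operatorname{rank}_\otimes(C)\le 2$. Let $\mathcal{N}$ be the set of tensors in $\mathbb{R}^{d_1\times d_2\times d_3}$ that have no best rank-$2$ approximation. Let $G_3\in\mathbb{R}^{2\times2\times2}$ be the tensor $$G_3=\left[\begin{array}{rr}1&0\\0&1\end{array}\right|\left.\begin{array}{rr}0&-1\\1&0\end{array}\right],$$ where the two blocks are the slabs $(g_{1jk})_{j,k}$ and $(g_{2jk})_{j,k}$,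 and let $G_3\oplus 0\in\mathbb{R}^{d_1\times d_2\times d_3}$ be its extension by zero. A tensor $A=(a_{ijk})\in\mathbb{R}^{d_1\times d_2\times d_3}$ is of type $G_3$ if there are $L\in\mathrm{GL}_{d_1}(\mathbb{R})$, $M\in\mathrm{GL}_{d_2}(\mathbb{R})$, $N\in\mathrm{GL}_{d_3}(\mathbb{R})$ with $$(G_3\oplus 0)_{pqr}=\sum_{i,j,k}L_{pi}M_{qj}N_{rk}\,a_{ijk}\quad\text{for all }p,q,r.$$ Theorem. There is a nonempty open set $U\subseteq\mathbb{R}^{d_1\times d_2\times d_3}$ that contains every tensor of type $G_3$ and satisfies $U\subseteq\mathcal{N}$. In particular, $\mathcal{N}$ is nonempty and has positive Lebesgue measure. -/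

import Mathlib

/-- The space `ℝ^{d₁ × d₂ × d₃}` of real three-way arrays. As a Euclidean space it carries the
Frobenius norm, and `volume` on it is Lebesgue measure. -/
abbrev Tensor3 (d₁ d₂ d₃ : ℕ) : Type :=
  EuclideanSpace ℝ (Fin d₁ × Fin d₂ × Fin d₃)

namespace Tensor3

/-- The norm of `Tensor3` is the Frobenius norm. -/
theorem norm_sq_eq_sum {d₁ d₂ d₃ : ℕ} (A : Tensor3 d₁ d₂ d₃) :
    ‖A‖ ^ 2 = ∑ i, ∑ j, ∑ k, |A (i, j, k)| ^ 2 := by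
  rw [EuclideanSpace.norm_sq_eq, Fintype.sum_prod_type]
  simp only [Fintype.sum_prod_type, Real.norm_eq_abs]

/-- The outer product `x ⊗ y ⊗ z`, that is, the array with entries `x i * y j * z k`. -/
noncomputable def outer {d₁ d₂ d₃ : ℕ} (x : Fin d₁ → ℝ) (y : Fin d₂ → ℝ) (z : Fin d₃ → ℝ) :
    Tensor3 d₁ d₂ d₃ :=
  WithLp.toLp 2 fun p => x p.1 * y p.2.1 * z p.2.2

/-- `A` is a sum of `r` decomposable tensors. -/
def IsSumOfOuter {d₁ d₂ d₃ : ℕ} (A : Tensor3 d₁ d₂ d₃) (r : ℕ) : Prop :=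
  ∃ (x : Fin r → Fin d₁ → ℝ) (y : Fin r → Fin d₂ → ℝ) (z : Fin r → Fin d₃ → ℝ),
    A = ∑ s, outer (x s) (y s) (z s)

/-- The outer-product rank: the least number of decomposable tensors with sum `A`. -/
noncomputable def rank {d₁ d₂ d₃ : ℕ} (A : Tensor3 d₁ d₂ d₃) : ℕ :=
  sInf {r : ℕ | IsSumOfOuter A r}

/-- Every tensor is a finite sum of decomposable tensors, so the minimum defining the rank is taken
over a nonempty set. -/
theorem exists_isSumOfOuter {d₁ d₂ d₃ : ℕ} (A : Tensor3 d₁ d₂ d₃) : ∃ r, IsSumOfOuter A r := by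
  let e := Fintype.equivFin (Fin d₁ × Fin d₂ × Fin d₃)
  refine ⟨Fintype.card (Fin d₁ × Fin d₂ × Fin d₃),
    fun s => Pi.single (e.symm s).1 (A (e.symm s)), fun s => Pi.single (e.symm s).2.1 1,
    fun s => Pi.single (e.symm s).2.2 1, ?_⟩
  rw [Equiv.sum_comp e.symm (fun p => outer (Pi.single p.1 (A p)) (Pi.single p.2.1 1)
    (Pi.single p.2.2 1))]
  ext ⟨i, j, k⟩
  simp [outer, Fintype.sum_prod_type, Pi.single_apply]

/-- `B` is a best rank-`r` approximation of `A` in the Frobenius norm: `B` minimizes `‖A - B‖`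
among the tensors of rank at most `r`. -/
def IsBestApprox {d₁ d₂ d₃ : ℕ} (A : Tensor3 d₁ d₂ d₃) (r : ℕ) (B : Tensor3 d₁ d₂ d₃) : Prop :=
  rank B ≤ r ∧ ∀ C : Tensor3 d₁ d₂ d₃, rank C ≤ r → ‖A - B‖ ≤ ‖A - C‖

/-- The tensors that have no best rank-`r` approximation in the Frobenius norm. -/
def noBestApprox (d₁ d₂ d₃ r : ℕ) : Set (Tensor3 d₁ d₂ d₃) :=
  {A | ¬ ∃ B, IsBestApprox A r B}

/-- Multilinear multiplication `(L, M, N) · A`. -/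
noncomputable def mulAct {c₁ c₂ c₃ d₁ d₂ d₃ : ℕ} (L : Matrix (Fin c₁) (Fin d₁) ℝ)
    (M : Matrix (Fin c₂) (Fin d₂) ℝ) (N : Matrix (Fin c₃) (Fin d₃) ℝ) (A : Tensor3 d₁ d₂ d₃) :
    Tensor3 c₁ c₂ c₃ :=
  WithLp.toLp 2 fun p => ∑ i, ∑ j, ∑ k, L p.1 i * M p.2.1 j * N p.2.2 k * A (i, j, k)

/-- The image `B ⊕ 0` of `B` under the canonical embedding
`ℝ^{c₁ × c₂ × c₃} ⊂ ℝ^{d₁ × d₂ × d₃}` (for `cᵢ ≤ dᵢ`): extension by zero from the leading block. -/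
noncomputable def extend {c₁ c₂ c₃ : ℕ} (d₁ d₂ d₃ : ℕ) (B : Tensor3 c₁ c₂ c₃) :
    Tensor3 d₁ d₂ d₃ :=
  WithLp.toLp 2 fun p =>
    if h : (p.1 : ℕ) < c₁ ∧ (p.2.1 : ℕ) < c₂ ∧ (p.2.2 : ℕ) < c₃ then
      B (⟨p.1, h.1⟩, ⟨p.2.1, h.2.1⟩, ⟨p.2.2, h.2.2⟩)
    else 0

/-- The tensor `G₃ = [1 0; 0 1 | 0 -1; 1 0]` of `ℝ^{2 × 2 × 2}`; the two slabs are the matrices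
`G₃ (0, ·, ·)` and `G₃ (1, ·, ·)`. -/
noncomputable def G₃ : Tensor3 2 2 2 :=
  WithLp.toLp 2 fun p =>
    (![!![1, 0; 0, 1], !![0, -1; 1, 0]] : Fin 2 → Matrix (Fin 2) (Fin 2) ℝ) p.1 p.2.1 p.2.2

/-- `A` has type `G₃`: it is `GL`-equivalent to `G₃ ⊕ 0`. -/
def IsTypeG₃ {d₁ d₂ d₃ : ℕ} (A : Tensor3 d₁ d₂ d₃) : Prop :=
  ∃ (L : GL (Fin d₁) ℝ) (M : GL (Fin d₂) ℝ) (N : GL (Fin d₃) ℝ),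
    extend d₁ d₂ d₃ G₃ =
      mulAct (L : Matrix (Fin d₁) (Fin d₁) ℝ) (M : Matrix (Fin d₂) (Fin d₂) ℝ)
        (N : Matrix (Fin d₃) (Fin d₃) ℝ) A

end Tensor3

/-!
The idea is to record a best rank-two approximation of `A` only through three orthonormal pairs of
vectors spanning a subspace `ℝ² ⊗ ℝ² ⊗ ℝ²` that contains it.

In `ℝ^{2 × 2 × 2}` the first-order conditions at a best rank-two approximation `b` of `a` leave no
room for a residual: they force `a = b`. By Pythagoras, a best rank-two approximation of a general
`A` is therefore the orthogonal projection of `A` onto the subspace of its frames, and the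
compression of `A` to this subspace has rank at most two, hence nonnegative hyperdeterminant. The
existence of frames with the last property, whose projection of `A` is moreover at least as close to
`A` as every tensor of rank at most two, is a closed condition on `A`, because the frames form a
compact set. Its complement is the required open set.

A tensor of type `G₃` violates the condition: it is embedded from a `2 × 2 × 2` tensor `a` with
negative hyperdeterminant. A compression of it is a multilinear image of `a`, so that a nonnegative
hyperdeterminant makes one of the three `2 × 2` matrices singular. Then the compression has rank at
most two, and the projection is a true best approximation; compressing it back to the frames of `A`
yields a best approximation of `a`, which equals `a` although `a` has rank greater than two.
-/

open Matrix

section LinearAlgebra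

variable {K V : Type*} [Field K]

theorem exists_smul_of_not_linearIndependent_pair [AddCommGroup V] [Module K V] {x y : V}
    (h : ¬ LinearIndependent K ![x, y]) : ∃ (v : V) (a b : K), x = a • v ∧ y = b • v := by
  by_cases hx : x = 0
  · exact ⟨y, 0, 1, by simp [hx], by simp⟩
  · simp only [LinearIndependent.pair_iff' hx, not_forall, not_not] at h
    obtain ⟨b, hb⟩ := h
    exact ⟨x, 1, b, by simp, hb.symm⟩

theorem exists_smul_add_smul_eq_of_linearIndependent_pair [AddCommGroup V] [Module K V]
    (hV : Module.finrank K V = 2) {x y : V} (h : LinearIndependent K ![x, y]) (u : V) :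
    ∃ a b : K, a • x + b • y = u := by
  have : FiniteDimensional K V := Module.finite_of_finrank_pos (by simp [hV])
  have hspan := h.span_eq_top_of_card_eq_finrank' (by simp [hV])
  rw [Matrix.range_cons_cons_empty] at hspan
  exact Submodule.mem_span_pair.1 (hspan ▸ Submodule.mem_top)

theorem exists_eq_vecMulVec_of_det_eq_zero {M : Matrix (Fin 2) (Fin 2) K} (h : M.det = 0) :
    ∃ p q : Fin 2 → K, M = vecMulVec p q := by
  have hrows : ¬ LinearIndependent K ![M 0, M 1] := fun hli => by
    have hM : M.row = ![M 0, M 1] := by ext i j; fin_cases i <;> rfl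
    rw [← hM, linearIndependent_rows_iff_isUnit, isUnit_iff_isUnit_det, h] at hli
    exact not_isUnit_zero hli
  obtain ⟨q, a, b, ha, hb⟩ := exists_smul_of_not_linearIndependent_pair hrows
  refine ⟨![a, b], q, ?_⟩
  ext i j
  fin_cases i
  · exact congrFun ha j
  · exact congrFun hb j

theorem inner_eq_zero_of_forall_norm_le_norm_sub_smul {E : Type*} [NormedAddCommGroup E]
    [InnerProductSpace ℝ E] {r e : E} (h : ∀ t : ℝ, ‖r‖ ≤ ‖r - t • e‖) : inner ℝ r e = 0 := by
  have hquad : ∀ t : ℝ, 0 ≤ ‖e‖ ^ 2 * (t * t) + (-2 * inner ℝ r e) * t + 0 := fun t => by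
    have ht := pow_le_pow_left₀ (norm_nonneg _) (h t) 2
    rw [norm_sub_sq_real, inner_smul_right, norm_smul, mul_pow, Real.norm_eq_abs, sq_abs] at ht
    linarith
  have hdiscrim := discrim_le_zero hquad
  rw [discrim] at hdiscrim
  exact pow_eq_zero_iff two_ne_zero |>.1 (le_antisymm (by linarith) (sq_nonneg _))

end LinearAlgebra

namespace Tensor3

variable {b₁ b₂ b₃ c₁ c₂ c₃ d₁ d₂ d₃ k r s : ℕ}

section Outer

variable (x x' : Fin d₁ → ℝ) (y y' : Fin d₂ → ℝ) (z z' : Fin d₃ → ℝ) (t : ℝ)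

theorem outer_apply (i : Fin d₁) (j : Fin d₂) (l : Fin d₃) :
    outer x y z (i, j, l) = x i * y j * z l := rfl

theorem dotProduct_mul_dotProduct_mul_dotProduct :
    (x ⬝ᵥ x') * (y ⬝ᵥ y') * (z ⬝ᵥ z') =
      ∑ i, ∑ j, ∑ l, x i * x' i * (y j * y' j) * (z l * z' l) := by
  rw [dotProduct, dotProduct, dotProduct, Finset.sum_mul_sum, Finset.sum_mul]
  exact Finset.sum_congr rfl fun i _ => Finset.sum_mul_sum ..

theorem inner_outer_outer :
    inner ℝ (outer x y z) (outer x' y' z') = (x ⬝ᵥ x') * (y ⬝ᵥ y') * (z ⬝ᵥ z') := by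
  rw [dotProduct_mul_dotProduct_mul_dotProduct, PiLp.inner_apply, Fintype.sum_prod_type]
  simp only [Fintype.sum_prod_type, outer_apply, RCLike.inner_apply, conj_trivial]
  exact Finset.sum_congr rfl fun i _ => Finset.sum_congr rfl fun j _ =>
    Finset.sum_congr rfl fun l _ => by ring

theorem outer_add_left : outer (x + x') y z = outer x y z + outer x' y z := by
  ext; simp [outer]; ring

theorem outer_add_middle : outer x (y + y') z = outer x y z + outer x y' z := by
  ext; simp [outer]; ring

theorem outer_add_right : outer x y (z + z') = outer x y z + outer x y z' := by
  ext; simp [outer]; ring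

theorem outer_smul_left : outer (t • x) y z = t • outer x y z := by
  ext; simp [outer]; ring

theorem outer_smul_middle : outer x (t • y) z = t • outer x y z := by
  ext; simp [outer]; ring

theorem outer_smul_right : outer x y (t • z) = t • outer x y z := by
  ext; simp [outer]; ring

theorem eq_zero_of_forall_inner_outer {A : Tensor3 d₁ d₂ d₃}
    (h : ∀ x y z, inner ℝ A (outer x y z) = 0) : A = 0 := by
  obtain ⟨r, x, y, z, hA⟩ := exists_isSumOfOuter A
  rw [← inner_self_eq_zero (𝕜 := ℝ)]
  conv_lhs => rw [hA, inner_sum, ← hA]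
  exact Finset.sum_eq_zero fun s _ => h (x s) (y s) (z s)

end Outer

section Rank

variable {A B : Tensor3 d₁ d₂ d₃}

theorem IsSumOfOuter.add (hA : IsSumOfOuter A r) (hB : IsSumOfOuter B s) :
    IsSumOfOuter (A + B) (r + s) := by
  obtain ⟨x, y, z, rfl⟩ := hA
  obtain ⟨x', y', z', rfl⟩ := hB
  exact ⟨Fin.append x x', Fin.append y y', Fin.append z z', by simp [Fin.sum_univ_add]⟩

theorem isSumOfOuter_zero (r : ℕ) : IsSumOfOuter (0 : Tensor3 d₁ d₂ d₃) r :=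
  ⟨0, 0, 0, by ext; simp [outer]⟩

theorem IsSumOfOuter.mono (h : IsSumOfOuter A r) (hrs : r ≤ s) : IsSumOfOuter A s := by
  obtain ⟨m, rfl⟩ := Nat.exists_eq_add_of_le hrs
  simpa using h.add (isSumOfOuter_zero m)

theorem isSumOfOuter_rank (A : Tensor3 d₁ d₂ d₃) : IsSumOfOuter A (rank A) :=
  Nat.sInf_mem (exists_isSumOfOuter A)

theorem rank_le_iff : rank A ≤ r ↔ IsSumOfOuter A r :=
  ⟨(isSumOfOuter_rank A).mono, fun h => Nat.sInf_le h⟩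

theorem rank_add_le (A B : Tensor3 d₁ d₂ d₃) : rank (A + B) ≤ rank A + rank B :=
  rank_le_iff.2 ((isSumOfOuter_rank A).add (isSumOfOuter_rank B))

theorem rank_outer_le_one (x : Fin d₁ → ℝ) (y : Fin d₂ → ℝ) (z : Fin d₃ → ℝ) :
    rank (outer x y z) ≤ 1 :=
  rank_le_iff.2 ⟨fun _ => x, fun _ => y, fun _ => z, by simp⟩

theorem rank_outer_add_le (x : Fin d₁ → ℝ) (y : Fin d₂ → ℝ) (z : Fin d₃ → ℝ) (hB : rank B ≤ r) :
    rank (outer x y z + B) ≤ r + 1 := by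
  have hadd := rank_add_le (outer x y z) B
  have hone := rank_outer_le_one x y z
  omega

theorem exists_eq_outer_add_outer_of_rank_le_two (h : rank A ≤ 2) :
    ∃ x y z x' y' z', A = outer x y z + outer x' y' z' := by
  obtain ⟨x, y, z, hA⟩ := rank_le_iff.1 h
  exact ⟨_, _, _, _, _, _, hA.trans (Fin.sum_univ_two _)⟩

end Rank

section MulAct

variable (L : Matrix (Fin c₁) (Fin d₁) ℝ) (M : Matrix (Fin c₂) (Fin d₂) ℝ)
  (N : Matrix (Fin c₃) (Fin d₃) ℝ)

theorem mulAct_apply (A : Tensor3 d₁ d₂ d₃) (p : Fin c₁ × Fin c₂ × Fin c₃) :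
    mulAct L M N A p = ∑ i, ∑ j, ∑ l, L p.1 i * M p.2.1 j * N p.2.2 l * A (i, j, l) := rfl

theorem mulAct_add (A B : Tensor3 d₁ d₂ d₃) :
    mulAct L M N (A + B) = mulAct L M N A + mulAct L M N B := by
  ext p
  simp [mulAct_apply, mul_add, Finset.sum_add_distrib]

theorem mulAct_smul (t : ℝ) (A : Tensor3 d₁ d₂ d₃) :
    mulAct L M N (t • A) = t • mulAct L M N A := by
  ext p
  simp [mulAct_apply, Finset.mul_sum, mul_left_comm]

/-- Multilinear multiplication `(L, M, N) · A` as a linear map in `A`. -/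
noncomputable def mulActₗ : Tensor3 d₁ d₂ d₃ →ₗ[ℝ] Tensor3 c₁ c₂ c₃ where
  toFun := mulAct L M N
  map_add' := mulAct_add L M N
  map_smul' := mulAct_smul L M N

theorem mulAct_sub (A B : Tensor3 d₁ d₂ d₃) :
    mulAct L M N (A - B) = mulAct L M N A - mulAct L M N B :=
  map_sub (mulActₗ L M N) A B

theorem mulAct_sum {ι : Type*} (S : Finset ι) (A : ι → Tensor3 d₁ d₂ d₃) :
    mulAct L M N (∑ i ∈ S, A i) = ∑ i ∈ S, mulAct L M N (A i) :=
  map_sum (mulActₗ L M N) A S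

theorem mulAct_one (A : Tensor3 d₁ d₂ d₃) : mulAct 1 1 1 A = A := by
  ext p
  simp [mulAct_apply, Matrix.one_apply]

theorem mulAct_outer (x : Fin d₁ → ℝ) (y : Fin d₂ → ℝ) (z : Fin d₃ → ℝ) :
    mulAct L M N (outer x y z) = outer (L *ᵥ x) (M *ᵥ y) (N *ᵥ z) := by
  ext ⟨p, q, s⟩
  rw [mulAct_apply, outer_apply, mulVec, mulVec, mulVec, dotProduct_mul_dotProduct_mul_dotProduct]
  simp only [outer_apply]
  exact Finset.sum_congr rfl fun i _ => Finset.sum_congr rfl fun j _ =>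
    Finset.sum_congr rfl fun l _ => by ring

theorem mulAct_mulAct (L : Matrix (Fin b₁) (Fin c₁) ℝ) (M : Matrix (Fin b₂) (Fin c₂) ℝ)
    (N : Matrix (Fin b₃) (Fin c₃) ℝ) (L' : Matrix (Fin c₁) (Fin d₁) ℝ)
    (M' : Matrix (Fin c₂) (Fin d₂) ℝ) (N' : Matrix (Fin c₃) (Fin d₃) ℝ) (A : Tensor3 d₁ d₂ d₃) :
    mulAct L M N (mulAct L' M' N' A) = mulAct (L * L') (M * M') (N * N') A := by
  obtain ⟨r, x, y, z, rfl⟩ := exists_isSumOfOuter A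
  simp only [mulAct_sum, mulAct_outer, mulVec_mulVec]

theorem inner_mulAct (A : Tensor3 d₁ d₂ d₃) (B : Tensor3 c₁ c₂ c₃) :
    inner ℝ (mulAct L M N A) B = inner ℝ A (mulAct Lᵀ Mᵀ Nᵀ B) := by
  obtain ⟨r, x, y, z, rfl⟩ := exists_isSumOfOuter A
  obtain ⟨s, x', y', z', rfl⟩ := exists_isSumOfOuter B
  simp only [mulAct_sum, mulAct_outer, sum_inner, inner_sum, inner_outer_outer, dotProduct_mulVec,
    vecMul_transpose]

@[fun_prop]
theorem continuous_mulAct {X : Type*} [TopologicalSpace X] {L : X → Matrix (Fin c₁) (Fin d₁) ℝ}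
    {M : X → Matrix (Fin c₂) (Fin d₂) ℝ} {N : X → Matrix (Fin c₃) (Fin d₃) ℝ}
    {A : X → Tensor3 d₁ d₂ d₃} (hL : Continuous L) (hM : Continuous M) (hN : Continuous N)
    (hA : Continuous A) : Continuous fun a => mulAct (L a) (M a) (N a) (A a) := by
  unfold mulAct
  have hL' := fun i j => hL.matrix_elem i j
  have hM' := fun i j => hM.matrix_elem i j
  have hN' := fun i j => hN.matrix_elem i j
  fun_prop

theorem rank_mulAct_le (A : Tensor3 d₁ d₂ d₃) : rank (mulAct L M N A) ≤ rank A := by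
  obtain ⟨x, y, z, hA⟩ := isSumOfOuter_rank A
  refine rank_le_iff.2 ⟨fun s => L *ᵥ x s, fun s => M *ᵥ y s, fun s => N *ᵥ z s, ?_⟩
  conv_lhs => rw [hA]
  simp only [mulAct_sum, mulAct_outer]

theorem rank_mulAct_vecMulVec_le (p : Fin c₁ → ℝ) (q : Fin d₁ → ℝ) (A : Tensor3 d₁ d₂ d₃) :
    rank (mulAct (vecMulVec p q) M N A) ≤ c₂ := by
  refine rank_le_iff.2 ⟨fun _ => p, fun j => Pi.single j 1,
    fun j l => ∑ i, ∑ j', ∑ l', q i * M j j' * N l l' * A (i, j', l'), ?_⟩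
  ext ⟨i, j, l⟩
  simp [mulAct_apply, outer, vecMulVec_apply, Pi.single_apply, Finset.mul_sum, mul_assoc]

end MulAct

section Rotate

/-- The cyclic permutation of the three modes, which moves the first mode to the end. -/
noncomputable def rotate : Tensor3 d₁ d₂ d₃ ≃ₗᵢ[ℝ] Tensor3 d₂ d₃ d₁ :=
  LinearIsometryEquiv.piLpCongrLeft 2 ℝ ℝ ((Equiv.prodComm _ _).trans (Equiv.prodAssoc _ _ _))

theorem rotate_apply (A : Tensor3 d₁ d₂ d₃) (j : Fin d₂) (l : Fin d₃) (i : Fin d₁) :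
    rotate A (j, l, i) = A (i, j, l) := rfl

theorem rotate_outer (x : Fin d₁ → ℝ) (y : Fin d₂ → ℝ) (z : Fin d₃ → ℝ) :
    rotate (outer x y z) = outer y z x := by
  ext ⟨j, l, i⟩
  simp only [rotate_apply, outer_apply]
  ring

theorem rotate_mulAct (L : Matrix (Fin c₁) (Fin d₁) ℝ) (M : Matrix (Fin c₂) (Fin d₂) ℝ)
    (N : Matrix (Fin c₃) (Fin d₃) ℝ) (A : Tensor3 d₁ d₂ d₃) :
    rotate (mulAct L M N A) = mulAct M N L (rotate A) := by
  obtain ⟨r, x, y, z, rfl⟩ := exists_isSumOfOuter A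
  simp only [mulAct_sum, mulAct_outer, map_sum, rotate_outer]

theorem rank_rotate_le (A : Tensor3 d₁ d₂ d₃) : rank (rotate A) ≤ rank A := by
  obtain ⟨x, y, z, hA⟩ := isSumOfOuter_rank A
  refine rank_le_iff.2 ⟨y, z, x, ?_⟩
  conv_lhs => rw [hA]
  simp only [map_sum, rotate_outer]

theorem rank_rotate (A : Tensor3 d₁ d₂ d₃) : rank (rotate A) = rank A :=
  (rank_rotate_le A).antisymm
    ((rank_rotate_le (rotate (rotate A))).trans (rank_rotate_le (rotate A)))

theorem IsBestApprox.rotate {A B : Tensor3 d₁ d₂ d₃} (h : IsBestApprox A r B) :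
    IsBestApprox (rotate A) r (rotate B) := by
  refine ⟨(rank_rotate B).trans_le h.1, fun C hC => ?_⟩
  obtain ⟨C, rfl⟩ := Tensor3.rotate.surjective C
  simp only [← map_sub, LinearIsometryEquiv.norm_map]
  exact h.2 C (rank_rotate C ▸ hC)

end Rotate

section CriticalPoint

variable {A B C : Tensor3 d₁ d₂ d₃} {x : Fin d₁ → ℝ} {y : Fin d₂ → ℝ} {z : Fin d₃ → ℝ}

theorem IsBestApprox.inner_eq_zero (h : IsBestApprox A r B) {E : Tensor3 d₁ d₂ d₃}
    (hE : ∀ t : ℝ, rank (B + t • E) ≤ r) : inner ℝ (A - B) E = 0 :=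
  inner_eq_zero_of_forall_norm_le_norm_sub_smul fun t => by
    simpa only [sub_sub] using h.2 _ (hE t)

theorem IsBestApprox.eq_of_rank_le (h : IsBestApprox A (r + 1) B) (hB : rank B ≤ r) : A = B := by
  refine sub_eq_zero.1 (eq_zero_of_forall_inner_outer fun x y z => h.inner_eq_zero fun t => ?_)
  rw [add_comm, ← outer_smul_left]
  exact rank_outer_add_le _ y z hB

theorem IsBestApprox.inner_outer_left (h : IsBestApprox A (r + 1) B) (hB : B = outer x y z + C)
    (hC : rank C ≤ r) (u : Fin d₁ → ℝ) : inner ℝ (A - B) (outer u y z) = 0 :=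
  h.inner_eq_zero fun t => by
    rw [hB, add_right_comm, ← outer_smul_left, ← outer_add_left]
    exact rank_outer_add_le _ _ _ hC

theorem IsBestApprox.inner_outer_middle (h : IsBestApprox A (r + 1) B)
    (hB : B = outer x y z + C) (hC : rank C ≤ r) (v : Fin d₂ → ℝ) :
    inner ℝ (A - B) (outer x v z) = 0 :=
  h.inner_eq_zero fun t => by
    rw [hB, add_right_comm, ← outer_smul_middle, ← outer_add_middle]
    exact rank_outer_add_le _ _ _ hC

theorem IsBestApprox.inner_outer_right (h : IsBestApprox A (r + 1) B)
    (hB : B = outer x y z + C) (hC : rank C ≤ r) (w : Fin d₃ → ℝ) :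
    inner ℝ (A - B) (outer x y w) = 0 :=
  h.inner_eq_zero fun t => by
    rw [hB, add_right_comm, ← outer_smul_right, ← outer_add_right]
    exact rank_outer_add_le _ _ _ hC

end CriticalPoint

section TwoByTwoByTwo

variable {a b : Tensor3 2 2 2} {x x' y y' z z' : Fin 2 → ℝ}

theorem IsBestApprox.eq_of_linearIndependent (h : IsBestApprox a 2 b)
    (hb : b = outer x y z + outer x' y' z') (hx : LinearIndependent ℝ ![x, x'])
    (hy : LinearIndependent ℝ ![y, y']) (hz : LinearIndependent ℝ ![z, z']) : a = b := by
  have hb' : b = outer x' y' z' + outer x y z := hb.trans (add_comm _ _)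
  have hC := rank_outer_le_one x y z
  have hC' := rank_outer_le_one x' y' z'
  have hdim : Module.finrank ℝ (Fin 2 → ℝ) = 2 := by simp
  refine sub_eq_zero.1 (eq_zero_of_forall_inner_outer fun u v w => ?_)
  obtain ⟨α, α', rfl⟩ := exists_smul_add_smul_eq_of_linearIndependent_pair hdim hx u
  obtain ⟨β, β', rfl⟩ := exists_smul_add_smul_eq_of_linearIndependent_pair hdim hy v
  obtain ⟨γ, γ', rfl⟩ := exists_smul_add_smul_eq_of_linearIndependent_pair hdim hz w
  -- Each of the eight products of basis vectors shares two factors with a summand of `b`.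
  simp only [outer_add_left, outer_add_middle, outer_add_right, outer_smul_left,
    outer_smul_middle, outer_smul_right, inner_add_right, inner_smul_right,
    h.inner_outer_left hb hC', h.inner_outer_middle hb hC', h.inner_outer_right hb hC',
    h.inner_outer_left hb' hC, h.inner_outer_middle hb' hC, h.inner_outer_right hb' hC,
    mul_zero, add_zero]

theorem IsBestApprox.eq_of_eq_outer_add_outer_same_right (h : IsBestApprox a 2 b)
    (hb : b = outer x y z + outer x' y' z) : a = b := by
  by_cases hx : LinearIndependent ℝ ![x, x']
  swap
  · obtain ⟨u, α, α', rfl, rfl⟩ := exists_smul_of_not_linearIndependent_pair hx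
    refine h.eq_of_rank_le ?_
    rw [hb, outer_smul_left, outer_smul_left, ← outer_smul_middle, ← outer_smul_middle,
      ← outer_add_middle]
    exact rank_outer_le_one _ _ _
  by_cases hy : LinearIndependent ℝ ![y, y']
  swap
  · obtain ⟨v, β, β', rfl, rfl⟩ := exists_smul_of_not_linearIndependent_pair hy
    refine h.eq_of_rank_le ?_
    rw [hb, outer_smul_middle, outer_smul_middle, ← outer_smul_left, ← outer_smul_left,
      ← outer_add_left]
    exact rank_outer_le_one _ _ _
  have hdim : Module.finrank ℝ (Fin 2 → ℝ) = 2 := by simp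
  refine sub_eq_zero.1 (eq_zero_of_forall_inner_outer fun u v w => ?_)
  have hxy := h.inner_outer_right hb (rank_outer_le_one _ _ _) w
  have hxy' := h.inner_outer_right (hb.trans (add_comm _ _)) (rank_outer_le_one _ _ _) w
  -- The matrix `x yᵀ + x' y'ᵀ` also equals `(x + x') yᵀ + x' (y' - y)ᵀ` and
  -- `x (y + y')ᵀ + (x' - x) y'ᵀ`.
  have hleft := h.inner_outer_right (x := x + x') (y := y) (z := z)
    (C := outer x' (y' - y) z) (by rw [hb]; ext; simp [outer]; ring) (rank_outer_le_one _ _ _) w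
  have hmiddle := h.inner_outer_right (x := x) (y := y + y') (z := z)
    (C := outer (x' - x) y' z) (by rw [hb]; ext; simp [outer]; ring) (rank_outer_le_one _ _ _) w
  rw [outer_add_left, inner_add_right, hxy, zero_add] at hleft
  rw [outer_add_middle, inner_add_right, hxy, zero_add] at hmiddle
  obtain ⟨α, α', rfl⟩ := exists_smul_add_smul_eq_of_linearIndependent_pair hdim hx u
  obtain ⟨β, β', rfl⟩ := exists_smul_add_smul_eq_of_linearIndependent_pair hdim hy v
  simp only [outer_add_left, outer_add_middle, outer_smul_left, outer_smul_middle,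
    inner_add_right, inner_smul_right, hxy, hxy', hleft, hmiddle, mul_zero, add_zero]

theorem IsBestApprox.eq_of_not_linearIndependent_right (h : IsBestApprox a 2 b)
    (hb : b = outer x y z + outer x' y' z') (hz : ¬ LinearIndependent ℝ ![z, z']) : a = b := by
  obtain ⟨w, γ, γ', rfl, rfl⟩ := exists_smul_of_not_linearIndependent_pair hz
  rw [outer_smul_right, outer_smul_right, ← outer_smul_left, ← outer_smul_left] at hb
  exact h.eq_of_eq_outer_add_outer_same_right hb

theorem IsBestApprox.eq (h : IsBestApprox a 2 b) : a = b := by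
  obtain ⟨x, y, z, x', y', z', hb⟩ := exists_eq_outer_add_outer_of_rank_le_two h.1
  by_cases hz : LinearIndependent ℝ ![z, z']
  swap
  · exact h.eq_of_not_linearIndependent_right hb hz
  by_cases hx : LinearIndependent ℝ ![x, x']
  swap
  · refine Tensor3.rotate.injective
      (h.rotate.eq_of_not_linearIndependent_right (x := y) (y := z) (x' := y') (y' := z') ?_ hx)
    rw [hb, map_add, rotate_outer, rotate_outer]
  by_cases hy : LinearIndependent ℝ ![y, y']
  swap
  · refine Tensor3.rotate.injective (Tensor3.rotate.injective
      (h.rotate.rotate.eq_of_not_linearIndependent_right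
        (x := z) (y := x) (x' := z') (y' := x') ?_ hy))
    simp only [hb, map_add, rotate_outer]
  exact h.eq_of_linearIndependent hb hx hy hz

end TwoByTwoByTwo

section Hyperdet

/-- Cayley's hyperdeterminant of a `2 × 2 × 2` tensor: the discriminant of the binary quadratic
form `det (s • S₀ + t • S₁)`, where `S₀` and `S₁` are the slabs of the tensor. It separates `G₃`,
where it is negative, from the tensors of rank at most two. -/
def hyperdet (a : Tensor3 2 2 2) : ℝ :=
  (a (0, 0, 0) * a (1, 1, 1) + a (0, 1, 1) * a (1, 0, 0) - a (0, 0, 1) * a (1, 1, 0)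
    - a (0, 1, 0) * a (1, 0, 1)) ^ 2
  - 4 * (a (0, 0, 0) * a (0, 1, 1) - a (0, 0, 1) * a (0, 1, 0))
    * (a (1, 0, 0) * a (1, 1, 1) - a (1, 0, 1) * a (1, 1, 0))

theorem continuous_hyperdet : Continuous hyperdet := by
  unfold hyperdet; fun_prop

theorem hyperdet_G₃_neg : hyperdet G₃ < 0 := by
  simp [hyperdet, G₃]

theorem hyperdet_outer_add_outer (x x' y y' z z' : Fin 2 → ℝ) :
    hyperdet (outer x y z + outer x' y' z') =
      ((of ![x, x']).det * (of ![y, y']).det * (of ![z, z']).det) ^ 2 := by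
  simp only [hyperdet, PiLp.add_apply, outer_apply, det_fin_two, of_apply, cons_val_zero,
    cons_val_one]
  ring

theorem hyperdet_nonneg_of_rank_le_two {a : Tensor3 2 2 2} (h : rank a ≤ 2) : 0 ≤ hyperdet a := by
  obtain ⟨x, y, z, x', y', z', rfl⟩ := exists_eq_outer_add_outer_of_rank_le_two h
  rw [hyperdet_outer_add_outer]
  positivity

theorem hyperdet_rotate (a : Tensor3 2 2 2) : hyperdet (rotate a) = hyperdet a := by
  simp only [hyperdet, rotate_apply]
  ring

theorem hyperdet_mulAct_left (L : Matrix (Fin 2) (Fin 2) ℝ) (a : Tensor3 2 2 2) :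
    hyperdet (mulAct L 1 1 a) = L.det ^ 2 * hyperdet a := by
  simp only [hyperdet, mulAct_apply, Fin.sum_univ_two, det_fin_two, one_apply_eq,
    one_apply_ne, ne_eq, zero_ne_one, one_ne_zero, not_false_eq_true]
  ring

theorem hyperdet_mulAct (L M N : Matrix (Fin 2) (Fin 2) ℝ) (a : Tensor3 2 2 2) :
    hyperdet (mulAct L M N a) = (L.det * M.det * N.det) ^ 2 * hyperdet a := by
  have hsplit : ∀ (P Q R : Matrix (Fin 2) (Fin 2) ℝ) (c : Tensor3 2 2 2),
      hyperdet (mulAct P Q R c) = P.det ^ 2 * hyperdet (mulAct Q R 1 (rotate c)) := by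
    intro P Q R c
    rw [← rotate_mulAct, hyperdet_rotate, ← hyperdet_mulAct_left, mulAct_mulAct, mul_one, one_mul,
      one_mul]
  rw [hsplit, hsplit, hsplit, mulAct_one, hyperdet_rotate, hyperdet_rotate, hyperdet_rotate]
  ring

theorem rank_mulAct_le_two_of_det_eq_zero {L : Matrix (Fin 2) (Fin 2) ℝ} (hL : L.det = 0)
    (M : Matrix (Fin 2) (Fin d₂) ℝ) (N : Matrix (Fin c₃) (Fin d₃) ℝ) (A : Tensor3 2 d₂ d₃) :
    rank (mulAct L M N A) ≤ 2 := by
  obtain ⟨p, q, rfl⟩ := exists_eq_vecMulVec_of_det_eq_zero hL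
  exact rank_mulAct_vecMulVec_le M N p q A

theorem rank_mulAct_le_two_of_det_mul_det_mul_det_eq_zero {L M N : Matrix (Fin 2) (Fin 2) ℝ}
    (h : L.det * M.det * N.det = 0) (a : Tensor3 2 2 2) : rank (mulAct L M N a) ≤ 2 := by
  rcases mul_eq_zero.1 h with h | hN
  · rcases mul_eq_zero.1 h with hL | hM
    · exact rank_mulAct_le_two_of_det_eq_zero hL M N a
    · rw [← rank_rotate, rotate_mulAct]
      exact rank_mulAct_le_two_of_det_eq_zero hM N L _
  · rw [← rank_rotate, ← rank_rotate, rotate_mulAct, rotate_mulAct]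
    exact rank_mulAct_le_two_of_det_eq_zero hN L M _

theorem rank_mulAct_le_two_of_hyperdet_nonneg {L M N : Matrix (Fin 2) (Fin 2) ℝ}
    {a : Tensor3 2 2 2} (ha : hyperdet a < 0) (h : 0 ≤ hyperdet (mulAct L M N a)) :
    rank (mulAct L M N a) ≤ 2 := by
  refine rank_mulAct_le_two_of_det_mul_det_mul_det_eq_zero ?_ a
  rw [hyperdet_mulAct] at h
  by_contra hdet
  exact absurd h (not_le.2 (mul_neg_of_pos_of_neg (by positivity) ha))

end Hyperdet

section Frames

/-- The orthonormal `k`-frames of `ℝ^d` (the Stiefel manifold), encoded as the matrices with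
orthonormal columns. -/
def frames (d k : ℕ) : Set (Matrix (Fin d) (Fin k) ℝ) := {U | Uᵀ * U = 1}

theorem isCompact_frames (d k : ℕ) : IsCompact (frames d k) := by
  have hcube : IsCompact (Set.univ.pi fun _ => Set.univ.pi fun _ => Set.Icc (-1) 1 :
      Set (Fin d → Fin k → ℝ)) :=
    isCompact_univ_pi fun _ => isCompact_univ_pi fun _ => isCompact_Icc
  refine hcube.of_isClosed_subset (isClosed_eq (by fun_prop) continuous_const)
    fun U hU i _ j _ => ?_
  have hcol : ∑ l, U l j * U l j = 1 := (congrFun (congrFun hU j) j).trans (one_apply_eq j)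
  have hentry : U i j * U i j ≤ 1 :=
    hcol ▸ Finset.single_le_sum (fun l _ => mul_self_nonneg (U l j)) (Finset.mem_univ i)
  exact abs_le.1 (abs_le_one_iff_mul_self_le_one.2 hentry)

instance (d k : ℕ) : CompactSpace (frames d k) :=
  isCompact_iff_compactSpace.1 (isCompact_frames d k)

theorem exists_frame_mul_transpose_mul_eq (hd : k ≤ d₁) (P : Matrix (Fin d₁) (Fin k) ℝ) :
    ∃ U ∈ frames d₁ k, U * Uᵀ * P = P := by
  obtain ⟨m, rfl⟩ := Nat.exists_eq_add_of_le hd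
  -- Gram–Schmidt, applied to the columns of `P` followed by `m` zero vectors.
  let f : Fin (k + m) → EuclideanSpace ℝ (Fin (k + m)) :=
    Fin.append (fun s => WithLp.toLp 2 (Pᵀ s)) 0
  let b := InnerProductSpace.gramSchmidtOrthonormalBasis (𝕜 := ℝ) (by simp) f
  let U : Matrix (Fin (k + m)) (Fin k) ℝ := of fun i j => b (Fin.castAdd m j) i
  have hU : Uᵀ * U = 1 := by
    ext i j
    have := orthonormal_iff_ite.1 b.orthonormal (Fin.castAdd m j) (Fin.castAdd m i)
    simpa [U, Matrix.mul_apply, PiLp.inner_apply, Matrix.one_apply, eq_comm] using this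
  refine ⟨U, hU, ?_⟩
  ext i s
  have htail : ∀ j : Fin m, inner ℝ (b (Fin.natAdd k j)) (f (Fin.castAdd m s)) = 0 := fun j =>
    InnerProductSpace.gramSchmidtOrthonormalBasis_inv_triangular _ _
      (by rw [Fin.lt_def, Fin.val_castAdd, Fin.val_natAdd]; omega)
  have hexpand := b.sum_repr' (f (Fin.castAdd m s))
  simp only [Fin.sum_univ_add (a := k), htail, zero_smul, Finset.sum_const_zero,
    add_zero] at hexpand
  have hf : f (Fin.castAdd m s) = WithLp.toLp 2 (Pᵀ s) := Fin.append_left _ _ s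
  have hentry := congrArg (fun v : EuclideanSpace ℝ (Fin (k + m)) => v i) hexpand
  rw [Matrix.mul_assoc]
  simpa [hf, PiLp.inner_apply, U, Matrix.mul_apply, mul_comm] using hentry

/-- Three orthonormal `k`-frames, one for each mode. They span a subspace `ℝ^k ⊗ ℝ^k ⊗ ℝ^k` of
`ℝ^{d₁ × d₂ × d₃}`. -/
abbrev FrameTriple (d₁ d₂ d₃ k : ℕ) : Type := frames d₁ k × frames d₂ k × frames d₃ k

namespace FrameTriple

variable (F : FrameTriple d₁ d₂ d₃ k)

/-- The isometric embedding of `ℝ^{k × k × k}` onto the subspace spanned by three `k`-frames. -/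
noncomputable def embed (a : Tensor3 k k k) : Tensor3 d₁ d₂ d₃ :=
  mulAct (F.1 : Matrix _ _ ℝ) (F.2.1 : Matrix _ _ ℝ) (F.2.2 : Matrix _ _ ℝ) a

/-- The adjoint of `embed`: the coordinates of the orthogonal projection of a tensor onto the
subspace spanned by three `k`-frames. -/
noncomputable def compress (A : Tensor3 d₁ d₂ d₃) : Tensor3 k k k :=
  mulAct (F.1 : Matrix _ _ ℝ)ᵀ (F.2.1 : Matrix _ _ ℝ)ᵀ (F.2.2 : Matrix _ _ ℝ)ᵀ A

theorem compress_embed (a : Tensor3 k k k) : F.compress (F.embed a) = a := by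
  obtain ⟨⟨U, hU⟩, ⟨V, hV⟩, ⟨W, hW⟩⟩ := F
  rw [compress, embed, mulAct_mulAct, hU, hV, hW, mulAct_one]

theorem norm_sub_embed_sq (A : Tensor3 d₁ d₂ d₃) (a : Tensor3 k k k) :
    ‖A - F.embed a‖ ^ 2 = ‖F.compress A - a‖ ^ 2 + ‖A - F.embed (F.compress A)‖ ^ 2 := by
  have hadj : ∀ (c : Tensor3 k k k) (B : Tensor3 d₁ d₂ d₃),
      inner ℝ (F.embed c) B = inner ℝ c (F.compress B) := inner_mulAct _ _ _
  have hcompress : F.compress (A - F.embed (F.compress A)) = 0 := by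
    rw [compress, mulAct_sub, ← compress, ← compress, compress_embed, sub_self]
  have hembed : F.embed (F.compress A - a) = F.embed (F.compress A) - F.embed a := mulAct_sub ..
  have hsplit : A - F.embed a = F.embed (F.compress A - a) + (A - F.embed (F.compress A)) := by
    rw [hembed]; abel
  have hisom : ‖F.embed (F.compress A - a)‖ ^ 2 = ‖F.compress A - a‖ ^ 2 := by
    rw [← real_inner_self_eq_norm_sq, hadj, compress_embed, real_inner_self_eq_norm_sq]
  rw [hsplit, norm_add_sq_real, hadj, hcompress, inner_zero_right, hisom]
  ring

theorem norm_embed_sub_embed (a c : Tensor3 k k k) : ‖F.embed a - F.embed c‖ = ‖a - c‖ := by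
  rw [← sq_eq_sq₀ (norm_nonneg _) (norm_nonneg _), norm_sub_embed_sq, compress_embed, sub_self,
    norm_zero]
  ring

theorem norm_compress_sub_le (A : Tensor3 d₁ d₂ d₃) (a : Tensor3 k k k) :
    ‖F.compress A - a‖ ≤ ‖A - F.embed a‖ := by
  refine le_of_sq_le_sq ?_ (norm_nonneg _)
  rw [norm_sub_embed_sq]
  exact le_add_of_nonneg_right (sq_nonneg _)

theorem exists_embed_compress_mulAct (hd₁ : k ≤ d₁) (hd₂ : k ≤ d₂) (hd₃ : k ≤ d₃)
    (P : Matrix (Fin d₁) (Fin k) ℝ) (Q : Matrix (Fin d₂) (Fin k) ℝ)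
    (R : Matrix (Fin d₃) (Fin k) ℝ) (a : Tensor3 k k k) :
    ∃ F : FrameTriple d₁ d₂ d₃ k, F.embed (F.compress (mulAct P Q R a)) = mulAct P Q R a := by
  obtain ⟨U, hU, hUP⟩ := exists_frame_mul_transpose_mul_eq hd₁ P
  obtain ⟨V, hV, hVQ⟩ := exists_frame_mul_transpose_mul_eq hd₂ Q
  obtain ⟨W, hW, hWR⟩ := exists_frame_mul_transpose_mul_eq hd₃ R
  refine ⟨(⟨U, hU⟩, ⟨V, hV⟩, ⟨W, hW⟩), ?_⟩
  rw [embed, compress, mulAct_mulAct, mulAct_mulAct]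
  dsimp only
  rw [hUP, hVQ, hWR]

theorem exists_embed_compress_of_rank_le (hd₁ : k ≤ d₁) (hd₂ : k ≤ d₂) (hd₃ : k ≤ d₃)
    {B : Tensor3 d₁ d₂ d₃} (hB : rank B ≤ k) :
    ∃ F : FrameTriple d₁ d₂ d₃ k, F.embed (F.compress B) = B := by
  obtain ⟨x, y, z, hB⟩ := rank_le_iff.1 hB
  have hmulAct : B = mulAct (of x)ᵀ (of y)ᵀ (of z)ᵀ
      (∑ s, outer (Pi.single s 1) (Pi.single s 1) (Pi.single s 1)) := by
    simp only [mulAct_sum, mulAct_outer, mulVec_single_one, hB]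
    rfl
  rw [hmulAct]
  exact exists_embed_compress_mulAct hd₁ hd₂ hd₃ _ _ _ _

variable {F} {A B : Tensor3 d₁ d₂ d₃}

theorem isBestApprox_compress (hB : F.embed (F.compress B) = B) (h : IsBestApprox A r B) :
    IsBestApprox (F.compress A) r (F.compress B) := by
  refine ⟨(rank_mulAct_le ..).trans h.1, fun c hc => ?_⟩
  have hle := pow_le_pow_left₀ (norm_nonneg _) (h.2 (F.embed c) ((rank_mulAct_le ..).trans hc)) 2
  have hAB := F.norm_sub_embed_sq A (F.compress B)
  rw [hB] at hAB
  rw [hAB, F.norm_sub_embed_sq A c] at hle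
  exact le_of_sq_le_sq (le_of_add_le_add_right hle) (norm_nonneg _)

theorem isBestApprox_compress_of_embed {a : Tensor3 k k k} (h : IsBestApprox (F.embed a) r B) :
    IsBestApprox a r (F.compress B) := by
  refine ⟨(rank_mulAct_le ..).trans h.1, fun c hc => ?_⟩
  calc ‖a - F.compress B‖ = ‖F.compress B - a‖ := norm_sub_rev _ _
    _ ≤ ‖B - F.embed a‖ := F.norm_compress_sub_le B a
    _ = ‖F.embed a - B‖ := norm_sub_rev _ _
    _ ≤ ‖F.embed a - F.embed c‖ := h.2 _ ((rank_mulAct_le ..).trans hc)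
    _ = ‖a - c‖ := F.norm_embed_sub_embed a c

end FrameTriple

end Frames

section FrameApproximable

/-- The tensors `A` that have three orthonormal `2`-frames to which the compression of `A` has
nonnegative hyperdeterminant, such that no tensor of rank at most two is closer to `A` than the
projection of `A` onto the subspace of these frames. This is a closed relaxation of having a best
rank-two approximation. -/
def frameApproximable (d₁ d₂ d₃ : ℕ) : Set (Tensor3 d₁ d₂ d₃) :=
  {A | ∃ F : FrameTriple d₁ d₂ d₃ 2, 0 ≤ hyperdet (F.compress A) ∧
    ∀ C, rank C ≤ 2 → ‖A - F.embed (F.compress A)‖ ≤ ‖A - C‖}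

theorem isClosed_frameApproximable (d₁ d₂ d₃ : ℕ) : IsClosed (frameApproximable d₁ d₂ d₃) := by
  let S : Set (FrameTriple d₁ d₂ d₃ 2 × Tensor3 d₁ d₂ d₃) :=
    {p | 0 ≤ hyperdet (p.1.compress p.2) ∧
      ∀ C, rank C ≤ 2 → ‖p.2 - p.1.embed (p.1.compress p.2)‖ ≤ ‖p.2 - C‖}
  have hcompress : Continuous fun p : FrameTriple d₁ d₂ d₃ 2 × Tensor3 d₁ d₂ d₃ =>
      p.1.compress p.2 := by
    unfold FrameTriple.compress; fun_prop
  have hembed : Continuous fun p : FrameTriple d₁ d₂ d₃ 2 × Tensor3 d₁ d₂ d₃ =>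
      p.1.embed (p.1.compress p.2) := by
    unfold FrameTriple.embed; fun_prop
  have hS : IsClosed S := by
    simp only [S, Set.ofPred_and, Set.ofPred_forall]
    refine (isClosed_le continuous_const (continuous_hyperdet.comp hcompress)).inter ?_
    exact isClosed_iInter fun C => isClosed_iInter fun _ => isClosed_le (by fun_prop) (by fun_prop)
  have himage : frameApproximable d₁ d₂ d₃ = Prod.snd '' S := by
    ext A; simp [frameApproximable, S]
  exact himage ▸ isClosedMap_snd_of_compactSpace S hS

theorem IsBestApprox.mem_frameApproximable (hd₁ : 2 ≤ d₁) (hd₂ : 2 ≤ d₂) (hd₃ : 2 ≤ d₃)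
    {A B : Tensor3 d₁ d₂ d₃} (h : IsBestApprox A 2 B) : A ∈ frameApproximable d₁ d₂ d₃ := by
  obtain ⟨F, hF⟩ := FrameTriple.exists_embed_compress_of_rank_le hd₁ hd₂ hd₃ h.1
  have hcompress := FrameTriple.isBestApprox_compress hF h
  have heq : F.compress A = F.compress B := hcompress.eq
  refine ⟨F, hyperdet_nonneg_of_rank_le_two ?_, ?_⟩
  · exact heq ▸ hcompress.1
  · rw [heq, hF]
    exact h.2

theorem not_isBestApprox_embed_of_hyperdet_neg (F : FrameTriple d₁ d₂ d₃ 2) {a : Tensor3 2 2 2}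
    (ha : hyperdet a < 0) (B : Tensor3 d₁ d₂ d₃) : ¬ IsBestApprox (F.embed a) 2 B := fun h => by
  have hcompress := FrameTriple.isBestApprox_compress_of_embed h
  have hrank : rank a ≤ 2 := hcompress.eq ▸ hcompress.1
  exact absurd (hyperdet_nonneg_of_rank_le_two hrank) (not_le.2 ha)

theorem embed_notMem_frameApproximable (F : FrameTriple d₁ d₂ d₃ 2) {a : Tensor3 2 2 2}
    (ha : hyperdet a < 0) : F.embed a ∉ frameApproximable d₁ d₂ d₃ := by
  rintro ⟨G, hG, hmin⟩
  have hrank : rank (G.compress (F.embed a)) ≤ 2 := by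
    rw [FrameTriple.compress, FrameTriple.embed, mulAct_mulAct] at hG ⊢
    exact rank_mulAct_le_two_of_hyperdet_nonneg ha hG
  exact not_isBestApprox_embed_of_hyperdet_neg F ha _ ⟨(rank_mulAct_le ..).trans hrank, hmin⟩

end FrameApproximable

section TypeG₃

/-- The leading `c` columns of the `d × d` identity matrix: the matrix of the canonical embedding
`ℝ^c ⊂ ℝ^d`. -/
def leadingColumns (d c : ℕ) : Matrix (Fin d) (Fin c) ℝ :=
  of fun p i => if (p : ℕ) = i then 1 else 0

theorem sum_leadingColumns_mul (p : Fin d₁) (f : Fin c₁ → ℝ) :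
    ∑ i, leadingColumns d₁ c₁ p i * f i = if h : (p : ℕ) < c₁ then f ⟨p, h⟩ else 0 := by
  split_ifs with h
  · simp [leadingColumns, ← Fin.ext_iff (a := ⟨p, h⟩)]
  · refine Finset.sum_eq_zero fun i _ => ?_
    rw [leadingColumns, of_apply, if_neg (by omega), zero_mul]

theorem transpose_leadingColumns_mul_leadingColumns (hcd : c₁ ≤ d₁) :
    (leadingColumns d₁ c₁)ᵀ * leadingColumns d₁ c₁ = 1 := by
  ext i j
  rw [Matrix.mul_apply, Finset.sum_eq_single (i.castLE hcd)]
  · simp [leadingColumns, Matrix.one_apply, Fin.ext_iff]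
  · intro p _ hp
    have hpi : (p : ℕ) ≠ i := fun h => hp (Fin.ext h)
    simp [leadingColumns, hpi]
  · simp

theorem extend_eq_mulAct (B : Tensor3 c₁ c₂ c₃) :
    extend d₁ d₂ d₃ B =
      mulAct (leadingColumns d₁ c₁) (leadingColumns d₂ c₂) (leadingColumns d₃ c₃) B := by
  ext ⟨p, q, r⟩
  simp only [mulAct_apply, mul_assoc, ← Finset.mul_sum, sum_leadingColumns_mul]
  simp only [extend]
  split_ifs <;> first | rfl | tauto

theorem isTypeG₃_extend_G₃ : IsTypeG₃ (extend d₁ d₂ d₃ G₃) :=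
  ⟨1, 1, 1, by simp [mulAct_one]⟩

theorem IsTypeG₃.exists_eq_mulAct_G₃ {A : Tensor3 d₁ d₂ d₃} (h : IsTypeG₃ A) :
    ∃ P Q R, A = mulAct P Q R G₃ := by
  obtain ⟨L, M, N, h⟩ := h
  have hA := congrArg (mulAct (↑L⁻¹ : Matrix (Fin d₁) (Fin d₁) ℝ)
    (↑M⁻¹ : Matrix (Fin d₂) (Fin d₂) ℝ) (↑N⁻¹ : Matrix (Fin d₃) (Fin d₃) ℝ)) h
  rw [mulAct_mulAct, Units.inv_mul, Units.inv_mul, Units.inv_mul, mulAct_one, extend_eq_mulAct,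
    mulAct_mulAct] at hA
  exact ⟨_, _, _, hA.symm⟩

theorem IsTypeG₃.exists_mulAct_eq_G₃ (hd₁ : 2 ≤ d₁) (hd₂ : 2 ≤ d₂) (hd₃ : 2 ≤ d₃)
    {A : Tensor3 d₁ d₂ d₃} (h : IsTypeG₃ A) : ∃ P Q R, mulAct P Q R A = G₃ := by
  obtain ⟨L, M, N, h⟩ := h
  have hG := congrArg
    (mulAct (leadingColumns d₁ 2)ᵀ (leadingColumns d₂ 2)ᵀ (leadingColumns d₃ 2)ᵀ) h
  rw [extend_eq_mulAct, mulAct_mulAct, mulAct_mulAct,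
    transpose_leadingColumns_mul_leadingColumns hd₁,
    transpose_leadingColumns_mul_leadingColumns hd₂,
    transpose_leadingColumns_mul_leadingColumns hd₃, mulAct_one] at hG
  exact ⟨_, _, _, hG.symm⟩

theorem IsTypeG₃.exists_eq_embed (hd₁ : 2 ≤ d₁) (hd₂ : 2 ≤ d₂) (hd₃ : 2 ≤ d₃)
    {A : Tensor3 d₁ d₂ d₃} (h : IsTypeG₃ A) :
    ∃ (F : FrameTriple d₁ d₂ d₃ 2) (a : Tensor3 2 2 2), hyperdet a < 0 ∧ A = F.embed a := by
  obtain ⟨P, Q, R, hA⟩ := h.exists_eq_mulAct_G₃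
  obtain ⟨F, hF⟩ := FrameTriple.exists_embed_compress_mulAct hd₁ hd₂ hd₃ P Q R G₃
  rw [← hA] at hF
  refine ⟨F, F.compress A, ?_, hF.symm⟩
  obtain ⟨P', Q', R', hG⟩ := h.exists_mulAct_eq_G₃ hd₁ hd₂ hd₃
  have hneg := hyperdet_G₃_neg
  rw [← hG, ← hF, FrameTriple.embed, mulAct_mulAct, hyperdet_mulAct] at hneg
  exact lt_of_not_ge fun hnonneg => absurd hneg (not_lt.2 (mul_nonneg (sq_nonneg _) hnonneg))

end TypeG₃

end Tensor3

theorem theorem8p4 (d₁ d₂ d₃ : ℕ) (hd₁ : 2 ≤ d₁) (hd₂ : 2 ≤ d₂) (hd₃ : 2 ≤ d₃) :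
    (∃ U : Set (Tensor3 d₁ d₂ d₃), IsOpen U ∧ U.Nonempty ∧
      {A : Tensor3 d₁ d₂ d₃ | Tensor3.IsTypeG₃ A} ⊆ U ∧ U ⊆ Tensor3.noBestApprox d₁ d₂ d₃ 2) ∧
    (Tensor3.noBestApprox d₁ d₂ d₃ 2).Nonempty ∧
    0 < MeasureTheory.volume (Tensor3.noBestApprox d₁ d₂ d₃ 2) := by
  have hopen : IsOpen (Tensor3.frameApproximable d₁ d₂ d₃)ᶜ :=
    (Tensor3.isClosed_frameApproximable d₁ d₂ d₃).isOpen_compl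
  have htype : {A : Tensor3 d₁ d₂ d₃ | Tensor3.IsTypeG₃ A} ⊆
      (Tensor3.frameApproximable d₁ d₂ d₃)ᶜ := fun A hA => by
    obtain ⟨F, a, ha, rfl⟩ := hA.exists_eq_embed hd₁ hd₂ hd₃
    exact Tensor3.embed_notMem_frameApproximable F ha
  have hsub : (Tensor3.frameApproximable d₁ d₂ d₃)ᶜ ⊆ Tensor3.noBestApprox d₁ d₂ d₃ 2 :=
    fun A hA ⟨B, hB⟩ => hA (hB.mem_frameApproximable hd₁ hd₂ hd₃)
  have hne : (Tensor3.frameApproximable d₁ d₂ d₃)ᶜ.Nonempty :=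
    ⟨_, htype Tensor3.isTypeG₃_extend_G₃⟩
  exact ⟨⟨_, hopen, hne, htype, hsub⟩, hne.mono hsub,
    (hopen.measure_pos _ hne).trans_le (MeasureTheory.measure_mono hsub)⟩
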